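/- All graphs are finite and simple. A split partition $(C,S)$ of a graph $G$ is a partition of its vertex set into a clique $C$ and a stable set $S$; $G$ is a split graph if it has one. The gem is the graph with vertices $a,b,c,d,e$ and edges $ab,bc,cd,ea,eb,ec,ed$; a graph is gem-free if it has no induced subgraph isomorphic to the gem. The bull is the graph with vertices $a,b,c,d,e$ and edges $ab,bc,cd,eb,ec$. Let $S_5$ be the graph on 15 vertices obtained from three vertex-disjoint bulls by adding all edges between vertices of degree three of different bulls (so that the six vertices of degree three form a clique, and there is no other edge between different bulls). An $\llcorner$-path is a path on the rectangular grid $\mathbb{Z}\times\mathbb{Z}$ with exactly one bend, consisting of a horizontal segment running to the right of the bend-point and a vertical segment running upwards from it, each with at least one grid edge. A $[\llcorner]$-representation of $G$ assigns to each vertex $v$ an $\llcorner$-path $P_v$ so that two distinct vertices $u,v$ are adjacent if and only if $P_u$ and $P_v$ share a grid edge. Theorem. (1) Let $G$ be a gem-free graph with a split partition $(C,S)$. Then $G$ admits a $[\llcorner]$-representation if and only if $G$ does not contain $S_5$ as an induced subgraph. (2) The gem-free split graphs that admit a $[\llcorner]$-representation can be recognized in polynomial time: there is an algorithm (on a random access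 machine with unit-cost addition, subtraction and indirect addressing, and without multiplication) which, given the adjacency matrix of an arbitrary graph $G$ on $n$ vertices, decides in a number of steps bounded by a polynomial in $n$ whether $G$ is a gem-free split graph that admits a $[\llcorner]$-representation. -/

import Mathlib

/-! ### Split graphs and the forbidden graphs -/

/-- `(C, S)` is a split partition of `G`: the vertex set is partitioned into a clique `C` and a
stable set `S` (either of which may be empty). -/
structure IsSplitPartition {V : Type*} (G : SimpleGraph V) (C S : Set V) : Prop where
  cover : C ∪ S = Set.univ
  disj : Disjoint C S
  clique : G.IsClique C
  stable : G.IsIndepSet S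

/-- `G` is a split graph. -/
def IsSplitGraph {V : Type*} (G : SimpleGraph V) : Prop :=
  ∃ C S : Set V, IsSplitPartition G C S

/-- The gem: vertices `a, b, c, d, e = 0, 1, 2, 3, 4`, edges `ab, bc, cd, ea, eb, ec, ed`. -/
def gem : SimpleGraph (Fin 5) :=
  SimpleGraph.fromEdgeSet
    {s(0, 1), s(1, 2), s(2, 3), s(4, 0), s(4, 1), s(4, 2), s(4, 3)}

/-- The bull: vertices `a, b, c, d, e = 0, 1, 2, 3, 4`, edges `ab, bc, cd, eb, ec`.
The vertices of degree three are `b = 1` and `c = 2`. -/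
def bull : SimpleGraph (Fin 5) :=
  SimpleGraph.fromEdgeSet {s(0, 1), s(1, 2), s(2, 3), s(4, 1), s(4, 2)}

/-- The graph `S₅` on 15 vertices: three vertex-disjoint bulls, indexed by `Fin 3`, whose six
vertices of degree three (the vertices `1` and `2` of each bull) are joined into one clique,
with no other edge between different bulls. -/
def graphS5 : SimpleGraph (Fin 3 × Fin 5) where
  Adj u v := (u.1 = v.1 ∧ bull.Adj u.2 v.2) ∨
    (u.1 ≠ v.1 ∧ (u.2 = 1 ∨ u.2 = 2) ∧ (v.2 = 1 ∨ v.2 = 2))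
  symm := ⟨by
    rintro u v (⟨h, h'⟩ | ⟨h, hu, hv⟩)
    · exact Or.inl ⟨h.symm, h'.symm⟩
    · exact Or.inr ⟨h.symm, hv, hu⟩⟩
  loopless := ⟨by
    rintro u (⟨-, h⟩ | ⟨h, -⟩)
    · exact bull.irrefl h
    · exact h rfl⟩

/-! ### `⌞`-shaped paths on the grid -/

/-- The edges of the rectangular grid `ℤ × ℤ`. -/
inductive GridEdge
  /-- the horizontal edge joining `(x, y)` and `(x + 1, y)` -/
  | horiz (x y : ℤ)
  /-- the vertical edge joining `(x, y)` and `(x, y + 1)` -/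
  | vert (x y : ℤ)

/-- A `⌞`-shaped path on the grid: the bend-point `(x, y)` is the lower left corner, the horizontal
segment runs from it to `(right, y)` and the vertical segment runs from it to `(x, top)`. -/
structure LPath where
  x : ℤ
  y : ℤ
  right : ℤ
  top : ℤ
  x_lt_right : x < right
  y_lt_top : y < top

/-- The set of grid edges of a `⌞`-shaped path. -/
def LPath.edges (P : LPath) : Set GridEdge :=
  {e | (∃ i, P.x ≤ i ∧ i < P.right ∧ e = GridEdge.horiz i P.y) ∨
    (∃ j, P.y ≤ j ∧ j < P.top ∧ e = GridEdge.vert P.x j)}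

/-- `P` is a `[⌞]`-representation of `G`: two distinct vertices are adjacent if and only if their
paths share a grid edge. -/
def IsLRepresentation {V : Type*} (G : SimpleGraph V) (P : V → LPath) : Prop :=
  ∀ u v : V, u ≠ v → (G.Adj u v ↔ ((P u).edges ∩ (P v).edges).Nonempty)

/-- `G` admits a `[⌞]`-representation. -/
def IsLGraph {V : Type*} (G : SimpleGraph V) : Prop :=
  ∃ P : V → LPath, IsLRepresentation G P

/-! ### Polynomial-time recognition of graph classes

Structured programs of a random access machine. The registers `0, 1, 2, …` hold natural numbers
and are also addressed indirectly. The input graph, with vertices `0, …, n - 1`, is given by its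
adjacency matrix, one entry of which can be read in one step. There is no multiplication, so that
the unit cost measure is polynomially equivalent to the running time of a Turing machine. -/

/-- Programs of the random access machine. -/
inductive RamProg
  /-- `R[d] := k` -/
  | const (d k : ℕ)
  /-- `R[d] := R[a] + R[b]` -/
  | add (d a b : ℕ)
  /-- `R[d] := R[a] - R[b]` (truncated at zero) -/
  | sub (d a b : ℕ)
  /-- `R[d] := R[R[a]]` -/
  | load (d a : ℕ)
  /-- `R[R[a]] := R[b]` -/
  | store (a b : ℕ)
  /-- `R[d] := 1` if `R[a]` and `R[b]` are adjacent vertices of the input graph,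
  `R[d] := 0` otherwise -/
  | query (d a b : ℕ)
  /-- first `p`, then `q` -/
  | seq (p q : RamProg)
  /-- if `R[a] ≠ 0` then `p` else `q` -/
  | cond (a : ℕ) (p q : RamProg)
  /-- while `R[a] ≠ 0` do `p` -/
  | loop (a : ℕ) (p : RamProg)

open Classical in
/-- Entry `(a, b)` of the adjacency matrix of `G` (zero outside the range of the matrix). -/
noncomputable def adjEntry {n : ℕ} (G : SimpleGraph (Fin n)) (a b : ℕ) : ℕ :=
  if ∃ (ha : a < n) (hb : b < n), G.Adj ⟨a, ha⟩ ⟨b, hb⟩ then 1 else 0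

/-- `RamExec A p R t R'`: on the matrix `A`, the program `p` started with register contents `R`
halts after exactly `t` steps with register contents `R'`. Each elementary instruction and each
test of a conditional or a loop costs one step. -/
inductive RamExec (A : ℕ → ℕ → ℕ) : RamProg → (ℕ → ℕ) → ℕ → (ℕ → ℕ) → Prop
  | const (d k : ℕ) (R : ℕ → ℕ) :
      RamExec A (.const d k) R 1 (Function.update R d k)
  | add (d a b : ℕ) (R : ℕ → ℕ) :
      RamExec A (.add d a b) R 1 (Function.update R d (R a + R b))
  | sub (d a b : ℕ) (R : ℕ → ℕ) :
      RamExec A (.sub d a b) R 1 (Function.update R d (R a - R b))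
  | load (d a : ℕ) (R : ℕ → ℕ) :
      RamExec A (.load d a) R 1 (Function.update R d (R (R a)))
  | store (a b : ℕ) (R : ℕ → ℕ) :
      RamExec A (.store a b) R 1 (Function.update R (R a) (R b))
  | query (d a b : ℕ) (R : ℕ → ℕ) :
      RamExec A (.query d a b) R 1 (Function.update R d (A (R a) (R b)))
  | seq {p q : RamProg} {R R' R'' : ℕ → ℕ} {t t' : ℕ}
      (hp : RamExec A p R t R') (hq : RamExec A q R' t' R'') :
      RamExec A (.seq p q) R (t + t') R''
  | cond_true {a : ℕ} {p q : RamProg} {R R' : ℕ → ℕ} {t : ℕ}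
      (ha : R a ≠ 0) (hp : RamExec A p R t R') :
      RamExec A (.cond a p q) R (t + 1) R'
  | cond_false {a : ℕ} {p q : RamProg} {R R' : ℕ → ℕ} {t : ℕ}
      (ha : R a = 0) (hq : RamExec A q R t R') :
      RamExec A (.cond a p q) R (t + 1) R'
  | loop_true {a : ℕ} {p : RamProg} {R R' R'' : ℕ → ℕ} {t t' : ℕ}
      (ha : R a ≠ 0) (hp : RamExec A p R t R') (hl : RamExec A (.loop a p) R' t' R'') :
      RamExec A (.loop a p) R (t + t' + 1) R''
  | loop_false {a : ℕ} {p : RamProg} {R : ℕ → ℕ} (ha : R a = 0) :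
      RamExec A (.loop a p) R 1 R

/-- The initial register contents for a graph with `n` vertices: `R[0] = n`, all others zero. -/
def ramInit (n : ℕ) : ℕ → ℕ := fun i => if i = 0 then n else 0

/-- The class `Q` of (labelled finite) graphs is recognizable in polynomial time: a single program
halts on every graph `G` within a number of steps polynomial in the number of vertices of `G`, and
answers, by `R[0] ≠ 0`, whether `G` belongs to `Q`. -/
def PolyTimeRecognizable (Q : ∀ n : ℕ, SimpleGraph (Fin n) → Prop) : Prop :=
  ∃ (p : RamProg) (f : Polynomial ℕ), ∀ (n : ℕ) (G : SimpleGraph (Fin n)),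
    ∃ (t : ℕ) (R : ℕ → ℕ), RamExec (adjEntry G) p (ramInit n) t R ∧
      t ≤ f.eval n ∧ (R 0 ≠ 0 ↔ Q n G)

/-! ### Intersections of `⌞`-shaped paths -/

/-! Necessity. The bends of a represented clique lie on one row or one column; after a reflection,
on a row. All clique paths then share a horizontal edge, and any other path meets them in one of
three ways: it cuts off those that bend early (left), those that end late (right), or tall ones in
one column. Traces of one horizontal type are nested, so each side can serve the top vertex of only
one bull of `graphS5`. If a column serves it, the two degree-three vertices share their bend column;
two column traces cannot separate them both ways, so a pendant vertex uses the right side. Hence at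
most two bulls fit.

Sufficiency. Without a gem, neighbourhoods of stable vertices that meet are nested. Call a stable
vertex branching if its neighbourhood contains two disjoint nonempty ones; three branching vertices
with pairwise disjoint neighbourhoods would give `graphS5`, so the branching vertices form two
chains (`exists_two_chains`). One chain is represented at the left ends of the clique paths, the
other at the right ends. The non-branching neighbourhoods group the clique into columns, in each of
which they form a chain, represented by vertical segments.

Recognition. Split graphs are the graphs without induced `twoEdges`, `fourCycle`, `fiveCycle`. The
class is therefore given by five forbidden induced subgraphs, a first-order condition, and a fixed
first-order sentence is evaluated by nested loops in polynomial time. -/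

theorem LPath.edges_inter_nonempty_iff (P Q : LPath) :
    (P.edges ∩ Q.edges).Nonempty ↔
      (P.y = Q.y ∧ P.x < Q.right ∧ Q.x < P.right) ∨ (P.x = Q.x ∧ P.y < Q.top ∧ Q.y < P.top) := by
  have h1 := P.x_lt_right
  have h2 := P.y_lt_top
  have h3 := Q.x_lt_right
  have h4 := Q.y_lt_top
  constructor
  · rintro ⟨e, ⟨i, hi, hi', rfl⟩ | ⟨i, hi, hi', rfl⟩, ⟨j, hj, hj', he⟩ | ⟨j, hj, hj', he⟩⟩ <;>
      simp only [GridEdge.horiz.injEq, GridEdge.vert.injEq, reduceCtorEq] at he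
    · left; omega
    · right; omega
  · rintro (⟨h, hx, hx'⟩ | ⟨h, hy, hy'⟩)
    · exact ⟨.horiz (max P.x Q.x) P.y, Or.inl ⟨max P.x Q.x, by omega, by omega, rfl⟩,
        Or.inl ⟨max P.x Q.x, by omega, by omega, by rw [h]⟩⟩
    · exact ⟨.vert P.x (max P.y Q.y), Or.inr ⟨max P.y Q.y, by omega, by omega, rfl⟩,
        Or.inr ⟨max P.y Q.y, by omega, by omega, by rw [h]⟩⟩

/-- The reflection of a `⌞`-shaped path in the diagonal. -/
def LPath.transpose (P : LPath) : LPath where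
  x := P.y
  y := P.x
  right := P.top
  top := P.right
  x_lt_right := P.y_lt_top
  y_lt_top := P.x_lt_right

theorem IsLRepresentation.transpose {V : Type*} {G : SimpleGraph V} {P : V → LPath}
    (h : IsLRepresentation G P) : IsLRepresentation G (fun v => (P v).transpose) := by
  intro u v huv
  rw [h u v huv, LPath.edges_inter_nonempty_iff, LPath.edges_inter_nonempty_iff]
  exact or_comm

theorem IsLGraph.of_isIndContained {V W : Type*} {H : SimpleGraph W} {G : SimpleGraph V}
    (h : IsLGraph G) (hH : H.IsIndContained G) : IsLGraph H := by
  obtain ⟨P, hP⟩ := h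
  obtain ⟨f⟩ := hH
  refine ⟨fun w => P (f w), fun u v huv => ?_⟩
  rw [← hP _ _ (f.injective.ne huv), f.map_adj_iff]

/-- The bend-points of pairwise intersecting paths lie on one row or on one column. -/
theorem IsLRepresentation.row_or_column {V : Type*} {G : SimpleGraph V} {P : V → LPath}
    (h : IsLRepresentation G P) {K : Set V} (hK : G.IsClique K) :
    (∀ u ∈ K, ∀ v ∈ K, (P u).y = (P v).y) ∨ (∀ u ∈ K, ∀ v ∈ K, (P u).x = (P v).x) := by
  have key : ∀ u ∈ K, ∀ v ∈ K, (P u).y = (P v).y ∨ (P u).x = (P v).x := by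
    intro u hu v hv
    by_cases huv : u = v
    · simp [huv]
    · have := (h u v huv).1 (hK hu hv huv)
      rw [LPath.edges_inter_nonempty_iff] at this
      tauto
  by_contra hc
  push Not at hc
  -- `u` and `v` lie in one column but different rows, so `w` and `z`, each missing one of these
  -- rows, lie in that column too.
  obtain ⟨⟨u, hu, v, hv, huv⟩, w, hw, z, hz, hwz⟩ := hc
  have := key u hu v hv
  have := key u hu w hw
  have := key u hu z hz
  have := key v hv w hw
  have := key v hv z hz
  have := key w hw z hz
  omega

/-! ### The graph `S₅` has no representation -/

/-- The trace of a path on a family of paths with a common horizontal edge, whose bend-points,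
right ends and top ends are given by `x`, `r` and `t`. -/
inductive IsTrace {ι : Type*} (x r t : ι → ℤ) (N : ι → Prop) : Prop
  | left (a : ℤ) (h : ∀ q, N q ↔ x q < a)
  | right (a : ℤ) (h : ∀ q, N q ↔ a < r q)
  | column (a b : ℤ) (p : Prop) (h : ∀ q, N q ↔ x q = a ∧ b < t q ∧ p)

/-- All clique paths contain the edge just right of the rightmost bend `q₀`. A path on the row is
tested only at its right end if it starts at or before that bend, and only at its left end
otherwise; a path off the row can meet the clique only vertically. -/
theorem IsLRepresentation.isTrace {V : Type*} [Finite V] {G : SimpleGraph V} {P : V → LPath}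
    (h : IsLRepresentation G P) {K : Set V} (hK : G.IsClique K) (hne : K.Nonempty)
    (hy : ∀ u ∈ K, ∀ v ∈ K, (P u).y = (P v).y) (s : V) (hs : s ∉ K) :
    IsTrace (fun q : K => (P q).x) (fun q : K => (P q).right) (fun q : K => (P q).top)
      (fun q : K => G.Adj s q) := by
  obtain ⟨q₀, hq₀, hmax⟩ := Set.exists_max_image K (fun q => (P q).x) (Set.toFinite K) hne
  have hr : ∀ q ∈ K, (P q₀).x < (P q).right := by
    intro q hq
    have h1 := (P q).x_lt_right
    by_cases hqq : q = q₀
    · rw [← hqq]; exact h1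
    · have := (h q q₀ hqq).1 (hK hq hq₀ hqq)
      rw [LPath.edges_inter_nonempty_iff] at this
      omega
  have hadj : ∀ q ∈ K, (G.Adj s q ↔ ((P s).y = (P q₀).y ∧ (P s).x < (P q).right ∧
      (P q).x < (P s).right) ∨
        ((P q).x = (P s).x ∧ (P s).y < (P q).top ∧ (P q₀).y < (P s).top)) := by
    intro q hq
    have hsq : s ≠ q := by rintro rfl; exact hs hq
    rw [h s q hsq, LPath.edges_inter_nonempty_iff, hy q hq q₀ hq₀, eq_comm (a := (P q).x)]
  have hsr := (P s).x_lt_right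
  by_cases hys : (P s).y = (P q₀).y
  · by_cases hxs : (P s).x ≤ (P q₀).x
    · refine .left (P s).right fun ⟨q, hq⟩ => ?_
      have := hr q hq
      rw [hadj q hq]
      simp only
      omega
    · refine .right (P s).x fun ⟨q, hq⟩ => ?_
      have : (P q).x ≤ (P q₀).x := hmax q hq
      rw [hadj q hq]
      simp only
      omega
  · refine .column (P s).x (P s).y ((P q₀).y < (P s).top) fun ⟨q, hq⟩ => ?_
    rw [hadj q hq]
    simp only
    omega

/-- Three pairs `(b i, c i)` cannot be separated from each other, and within each pair, by
traces. -/
theorem not_isTrace_bulls {ι : Type*} {x r t : ι → ℤ} (b c : Fin 3 → ι) (A D E : Fin 3 → ι → Prop)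
    (hA : ∀ i, IsTrace x r t (A i)) (hD : ∀ i, IsTrace x r t (D i)) (hE : ∀ i, IsTrace x r t (E i))
    (hAb : ∀ i j, A i (b j) ↔ i = j) (hAc : ∀ i j, ¬ A i (c j))
    (hDc : ∀ i j, D i (c j) ↔ i = j) (hDb : ∀ i j, ¬ D i (b j))
    (hEb : ∀ i j, E i (b j) ↔ i = j) (hEc : ∀ i j, E i (c j) ↔ i = j) : False := by
  -- below a column trace `E i` there is a right trace that separates one of `b i`, `c i`
  -- from all the other points
  have hcol : ∀ i, (∃ u v p, ∀ q, E i q ↔ x q = u ∧ v < t q ∧ p) →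
      ∃ a, (a < r (b i) ∨ a < r (c i)) ∧ ∀ j, j ≠ i → ¬ a < r (b j) ∧ ¬ a < r (c j) := by
    rintro i ⟨u, v, p, h⟩
    have hb := (h _).1 ((hEb i i).2 rfl)
    have hc := (h _).1 ((hEc i i).2 rfl)
    have a1 := (hAb i i).2 rfl
    have a2 := hAc i i
    have d1 := (hDc i i).2 rfl
    have d2 := hDb i i
    -- `b i` and `c i` have the same bend column, so no left trace separates them.
    rcases hA i with ⟨a, ha⟩ | ⟨a, ha⟩ | ⟨a, a', p₁, ha⟩
    · rw [ha] at a1 a2; omega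
    · refine ⟨a, .inl ((ha _).1 a1), fun j hj => ⟨fun h' => ?_, fun h' => ?_⟩⟩
      · exact hj ((hAb i j).1 ((ha _).2 h')).symm
      · exact hAc i j ((ha _).2 h')
    rcases hD i with ⟨d, hd⟩ | ⟨d, hd⟩ | ⟨d, d', p₂, hd⟩
    · rw [hd] at d1 d2; omega
    · refine ⟨d, .inr ((hd _).1 d1), fun j hj => ⟨fun h' => ?_, fun h' => ?_⟩⟩
      · exact hDb i j ((hd _).2 h')
      · exact hj ((hDc i j).1 ((hd _).2 h')).symm
    · rw [ha] at a1 a2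
      rw [hd] at d1 d2
      -- Two column traces would force `t (c i) < t (b i)` and the reverse.
      have h1 : ¬ a' < t (c i) := fun h' => a2 ⟨by omega, h', a1.2.2⟩
      have h2 : ¬ d' < t (b i) := fun h' => d2 ⟨by omega, h', d1.2.2⟩
      omega
  -- Left traces are nested, whereas `E i` and `E j` each contain a point outside the other.
  have hLL : ∀ i j, i ≠ j → (∃ a, ∀ q, E i q ↔ x q < a) → (∃ a, ∀ q, E j q ↔ x q < a) → False := by
    rintro i j hij ⟨a, ha⟩ ⟨a', ha'⟩
    have h1 := (ha _).1 ((hEb i i).2 rfl)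
    have h2 := (ha' _).1 ((hEb j j).2 rfl)
    have h3 := mt (ha _).2 (mt (hEb i j).1 hij)
    have h4 := mt (ha' _).2 (mt (hEb j i).1 hij.symm)
    omega
  have hRR : ∀ i j, i ≠ j → (∃ a, ∀ q, E i q ↔ a < r q) → (∃ a, ∀ q, E j q ↔ a < r q) → False := by
    rintro i j hij ⟨a, ha⟩ ⟨a', ha'⟩
    have h1 := (ha _).1 ((hEb i i).2 rfl)
    have h2 := (ha' _).1 ((hEb j j).2 rfl)
    have h3 := mt (ha _).2 (mt (hEb i j).1 hij)
    have h4 := mt (ha' _).2 (mt (hEb j i).1 hij.symm)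
    omega
  have hKK : ∀ i j, i ≠ j → (∃ u v p, ∀ q, E i q ↔ x q = u ∧ v < t q ∧ p) →
      (∃ u v p, ∀ q, E j q ↔ x q = u ∧ v < t q ∧ p) → False := by
    intro i j hij hi hj
    obtain ⟨a, ha, ha'⟩ := hcol i hi
    obtain ⟨d, hd, hd'⟩ := hcol j hj
    have := ha' j hij.symm
    have := hd' i hij
    omega
  have hKR : ∀ i j, i ≠ j → (∃ u v p, ∀ q, E i q ↔ x q = u ∧ v < t q ∧ p) →
      (∃ a, ∀ q, E j q ↔ a < r q) → False := by
    rintro i j hij hi ⟨d, hd⟩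
    obtain ⟨a, ha, ha'⟩ := hcol i hi
    have := ha' j hij.symm
    have h1 := (hd _).1 ((hEb j j).2 rfl)
    have h2 := mt (hd _).2 (mt (hEb j i).1 hij.symm)
    have h3 := mt (hd _).2 (mt (hEc j i).1 hij.symm)
    omega
  have htype : ∀ i, (∃ a, ∀ q, E i q ↔ x q < a) ∨ (∃ a, ∀ q, E i q ↔ a < r q) ∨
      (∃ u v p, ∀ q, E i q ↔ x q = u ∧ v < t q ∧ p) := by
    intro i
    rcases hE i with ⟨a, ha⟩ | ⟨a, ha⟩ | ⟨a, a', p, ha⟩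
    · exact .inl ⟨a, ha⟩
    · exact .inr (.inl ⟨a, ha⟩)
    · exact .inr (.inr ⟨a, a', p, ha⟩)
  have d01 : (0 : Fin 3) ≠ 1 := by decide
  have d02 : (0 : Fin 3) ≠ 2 := by decide
  have d12 : (1 : Fin 3) ≠ 2 := by decide
  rcases htype 0 with h0 | h0 | h0 <;> rcases htype 1 with h1 | h1 | h1 <;>
    rcases htype 2 with h2 | h2 | h2 <;>
    first
    | exact hLL _ _ d01 h0 h1
    | exact hLL _ _ d02 h0 h2
    | exact hLL _ _ d12 h1 h2
    | exact hRR _ _ d01 h0 h1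
    | exact hRR _ _ d02 h0 h2
    | exact hRR _ _ d12 h1 h2
    | exact hKK _ _ d01 h0 h1
    | exact hKK _ _ d02 h0 h2
    | exact hKK _ _ d12 h1 h2
    | exact hKR _ _ d01 h0 h1
    | exact hKR _ _ d02 h0 h2
    | exact hKR _ _ d12 h1 h2
    | exact hKR _ _ d01.symm h1 h0
    | exact hKR _ _ d02.symm h2 h0
    | exact hKR _ _ d12.symm h2 h1

theorem not_isLGraph_graphS5 : ¬ IsLGraph graphS5 := by
  rintro ⟨P, hP⟩
  let K : Set (Fin 3 × Fin 5) := {u | u.2 = 1 ∨ u.2 = 2}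
  have hK : graphS5.IsClique K := by
    rintro ⟨i, u⟩ hu ⟨j, v⟩ hv huv
    by_cases hij : i = j
    · subst hij
      rcases hu with hu | hu <;> rcases hv with hv | hv <;> simp only at hu hv <;> subst hu <;>
        subst hv <;> simp_all [graphS5, bull]
    · exact .inr ⟨hij, hu, hv⟩
  have main : ∀ P, IsLRepresentation graphS5 P →
      (∀ u ∈ K, ∀ v ∈ K, (P u).y = (P v).y) → False := by
    intro P hP hy
    have htr := fun s hs => hP.isTrace hK ⟨(0, 1), .inl rfl⟩ hy s hs
    have hadj : ∀ (i j : Fin 3) (u v : Fin 5), u ≠ 1 → u ≠ 2 →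
        (graphS5.Adj (i, u) (j, v) ↔ i = j ∧ bull.Adj u v) := by
      intro i j u v h1 h2
      simp [graphS5, h1, h2]
    refine not_isTrace_bulls (fun i => (⟨(i, 1), .inl rfl⟩ : K)) (fun i => ⟨(i, 2), .inr rfl⟩)
      _ _ _ (fun i => htr (i, 0) (by simp [K])) (fun i => htr (i, 3) (by simp [K]))
      (fun i => htr (i, 4) (by simp [K])) ?_ ?_ ?_ ?_ ?_ ?_ <;>
      · intro i j
        rw [hadj _ _ _ _ (by decide) (by decide)]
        simp [bull]
  rcases hP.row_or_column hK with h | h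
  · exact main P hP h
  · exact main _ hP.transpose h

/-! ### Laminar neighbourhoods -/

/-- Injectivity is automatic when no two vertices of `H` have the same neighbours, so distinctness
of the images need not be checked. -/
theorem SimpleGraph.IsIndContained.of_adj_iff {V W : Type*} {H : SimpleGraph W} {G : SimpleGraph V}
    (f : W → V) (htwin : ∀ u v, (∀ w, H.Adj u w ↔ H.Adj v w) → u = v)
    (hf : ∀ u v, G.Adj (f u) (f v) ↔ H.Adj u v) : H.IsIndContained G :=
  ⟨⟨⟨f, fun u v huv => htwin u v fun w => by rw [← hf, ← hf, huv]⟩, hf _ _⟩⟩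

theorem bull_adj_iff (u v : Fin 5) : bull.Adj u v ↔
    (u, v) ∈ [(0, 1), (1, 0), (1, 2), (2, 1), (2, 3), (3, 2), (4, 1), (1, 4), (4, 2), (2, 4)] := by
  fin_cases u <;> fin_cases v <;> simp [bull]

theorem gem_adj_iff (u v : Fin 5) : gem.Adj u v ↔
    (u, v) ∈ [(0, 1), (1, 0), (1, 2), (2, 1), (2, 3), (3, 2), (4, 0), (0, 4), (4, 1), (1, 4),
      (4, 2), (2, 4), (4, 3), (3, 4)] := by
  fin_cases u <;> fin_cases v <;> simp [gem]

theorem eq_of_gem_adj_iff (u v : Fin 5) (h : ∀ w, gem.Adj u w ↔ gem.Adj v w) : u = v := by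
  simp only [gem_adj_iff] at h
  revert u v
  decide

theorem eq_of_bull_adj_iff (u v : Fin 5) (h : ∀ w, bull.Adj u w ↔ bull.Adj v w) : u = v := by
  simp only [bull_adj_iff] at h
  revert u v
  decide

theorem eq_of_graphS5_adj_iff (u v : Fin 3 × Fin 5) (h : ∀ w, graphS5.Adj u w ↔ graphS5.Adj v w) :
    u = v := by
  obtain ⟨i, u⟩ := u
  obtain ⟨j, v⟩ := v
  by_cases hij : i = j
  · subst hij
    refine Prod.ext rfl (eq_of_bull_adj_iff u v fun w => ?_)
    simpa [graphS5] using h (i, w)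
  · exfalso
    have hji : j ≠ i := fun e => hij e.symm
    have h1 := h (i, 1)
    have h2 := h (i, 2)
    have h3 := h (j, 0)
    have h4 := h (j, 3)
    simp only [graphS5, hij, hji, bull_adj_iff] at h1 h2 h3 h4
    clear h
    fin_cases u <;> fin_cases v <;> simp_all

namespace IsSplitPartition

variable {V : Type*} {G : SimpleGraph V} {C S : Set V}

theorem mem_or_mem (h : IsSplitPartition G C S) (v : V) : v ∈ C ∨ v ∈ S := by
  have : v ∈ C ∪ S := h.cover ▸ Set.mem_univ v
  exact this

theorem not_mem_left (h : IsSplitPartition G C S) {v : V} (hv : v ∈ S) : v ∉ C :=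
  fun h' => h.disj.notMem_of_mem_left h' hv

theorem not_adj (h : IsSplitPartition G C S) {s t : V} (hs : s ∈ S) (ht : t ∈ S) : ¬ G.Adj s t :=
  fun hst => h.stable hs ht hst.ne hst

theorem mem_left_of_adj (h : IsSplitPartition G C S) {s c : V} (hs : s ∈ S) (hc : G.Adj s c) :
    c ∈ C :=
  (h.mem_or_mem c).resolve_right fun hc' => h.not_adj hs hc' hc

/-- Otherwise private neighbours `b` of `s` and `c` of `t` give an induced path `s, b, c, t`, and a
common neighbour `e` completes it to a gem. -/
theorem neighborSet_laminar (h : IsSplitPartition G C S) (hg : ¬ gem.IsIndContained G) {s t : V}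
    (hs : s ∈ S) (ht : t ∈ S) (hst : ∃ e, G.Adj s e ∧ G.Adj t e) :
    G.neighborSet s ⊆ G.neighborSet t ∨ G.neighborSet t ⊆ G.neighborSet s := by
  by_contra hc
  rw [not_or, Set.not_subset, Set.not_subset] at hc
  obtain ⟨e, hse, hte⟩ := hst
  obtain ⟨⟨b, hsb, htb⟩, c, htc, hsc⟩ := hc
  rw [SimpleGraph.mem_neighborSet] at hsb htb htc hsc
  have hb := h.mem_left_of_adj hs hsb
  have hc := h.mem_left_of_adj ht htc
  have he := h.mem_left_of_adj hs hse
  have hbc : G.Adj b c := h.clique hb hc (by rintro rfl; exact hsc hsb)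
  have hbe : G.Adj b e := h.clique hb he (by rintro rfl; exact htb hte)
  have hce : G.Adj c e := h.clique hc he (by rintro rfl; exact hsc hse)
  have hst := h.not_adj hs ht
  refine hg (.of_adj_iff ![s, b, c, t, e] eq_of_gem_adj_iff fun u v => ?_)
  rw [gem_adj_iff]
  fin_cases u <;> fin_cases v <;>
    simp [hse, hte, hsb, htb, htc, hsc, hbc, hbe, hce, hst, hse.symm, hte.symm, hsb.symm,
      htc.symm, hbc.symm, hbe.symm, hce.symm, G.adj_comm t s, G.adj_comm b t, G.adj_comm c s]

end IsSplitPartition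

/-- The neighbourhood of `s` contains two disjoint nonempty neighbourhoods of vertices in `S`. -/
def IsBranching {V : Type*} (G : SimpleGraph V) (S : Set V) (s : V) : Prop :=
  ∃ a ∈ S, ∃ d ∈ S, G.neighborSet a ⊆ G.neighborSet s ∧ G.neighborSet d ⊆ G.neighborSet s ∧
    (G.neighborSet a).Nonempty ∧ (G.neighborSet d).Nonempty ∧ ∀ e, ¬ (G.Adj a e ∧ G.Adj d e)

theorem IsBranching.mono {V : Type*} {G : SimpleGraph V} {S : Set V} {s t : V}
    (h : IsBranching G S s) (hst : G.neighborSet s ⊆ G.neighborSet t) : IsBranching G S t := by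
  obtain ⟨a, ha, d, hd, h1, h2, h3⟩ := h
  exact ⟨a, ha, d, hd, h1.trans hst, h2.trans hst, h3⟩

/-- The two disjoint neighbourhoods inside that of `s i` supply the pendant vertices `a i`, `d i`;
neighbours `b i`, `c i` of these are the degree-three vertices of a bull with top `s i`. -/
theorem IsSplitPartition.graphS5_isIndContained {V : Type*} {G : SimpleGraph V} {C S : Set V}
    (h : IsSplitPartition G C S) (s : Fin 3 → V) (hs : ∀ i, s i ∈ S)
    (hbr : ∀ i, IsBranching G S (s i))
    (hdisj : ∀ i j, i ≠ j → ∀ e, ¬ (G.Adj (s i) e ∧ G.Adj (s j) e)) :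
    graphS5.IsIndContained G := by
  choose a ha d hd has hds hane hdne had using hbr
  choose b hab using hane
  choose c hdc using hdne
  have hsb := fun i => has i (hab i)
  have hsc := fun i => hds i (hdc i)
  simp only [SimpleGraph.mem_neighborSet] at hab hdc hsb hsc
  have hdb : ∀ i, ¬ G.Adj (d i) (b i) := fun i hi => had i _ ⟨hab i, hi⟩
  have hac : ∀ i, ¬ G.Adj (a i) (c i) := fun i hi => had i _ ⟨hi, hdc i⟩
  have hb := fun i => h.mem_left_of_adj (ha i) (hab i)
  have hc := fun i => h.mem_left_of_adj (hd i) (hdc i)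
  have hbc : ∀ i, G.Adj (b i) (c i) := fun i =>
    h.clique (hb i) (hc i) fun e => hac i (e ▸ hab i)
  have hfar : ∀ i j, i ≠ j → ∀ v, (v = a i ∨ v = d i ∨ v = s i) → ∀ w, (w = b j ∨ w = c j) →
      ¬ G.Adj v w := by
    intro i j hij v hv w hw hvw
    have h1 : G.Adj (s j) w := by rcases hw with rfl | rfl <;> simp [hsb, hsc]
    have h2 : G.Adj (s i) w := by
      rcases hv with rfl | rfl | rfl
      · exact has i hvw
      · exact hds i hvw
      · exact hvw
    exact hdisj i j hij w ⟨h2, h1⟩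
  have hnear : ∀ i j, i ≠ j → ∀ v, (v = b i ∨ v = c i) → ∀ w, (w = b j ∨ w = c j) →
      G.Adj v w := by
    intro i j hij v hv w hw
    have h1 : G.Adj (s i) v := by rcases hv with rfl | rfl <;> simp [hsb, hsc]
    have h2 : G.Adj (s j) w := by rcases hw with rfl | rfl <;> simp [hsb, hsc]
    refine h.clique (h.mem_left_of_adj (hs i) h1) (h.mem_left_of_adj (hs j) h2) ?_
    rintro rfl
    exact hdisj i j hij v ⟨h1, h2⟩
  have hSS : ∀ v ∈ S, ∀ w ∈ S, ¬ G.Adj v w := fun v hv w hw => h.not_adj hv hw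
  refine .of_adj_iff (fun u : Fin 3 × Fin 5 => ![a u.1, b u.1, c u.1, d u.1, s u.1] u.2)
    eq_of_graphS5_adj_iff ?_
  rintro ⟨i, u⟩ ⟨j, v⟩
  by_cases hij : i = j
  · subst hij
    have : graphS5.Adj (i, u) (i, v) ↔ bull.Adj u v := by simp [graphS5]
    rw [this, bull_adj_iff]
    fin_cases u <;> fin_cases v <;>
      simp [hab, hdc, hsb, hsc, hdb, hac, hbc, (hab _).symm, (hdc _).symm, (hsb _).symm,
        (hsc _).symm, (hbc _).symm, G.adj_comm (b _) (d _), G.adj_comm (c _) (a _), hSS, ha, hd,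
        hs]
  · have : graphS5.Adj (i, u) (j, v) ↔ (u = 1 ∨ u = 2) ∧ (v = 1 ∨ v = 2) := by
      simp [graphS5, hij]
    rw [this]
    have hji : j ≠ i := fun e => hij e.symm
    have hfar' : ∀ v, (v = a j ∨ v = d j ∨ v = s j) → ∀ w, (w = b i ∨ w = c i) →
      ¬ G.Adj w v := fun v hv w hw hvw => hfar j i hji v hv w hw hvw.symm
    fin_cases u <;> fin_cases v <;> simp [hfar i j hij, hfar', hnear i j hij, hSS, ha, hd, hs]

/-- The branching vertices of a gem-free split graph without `S₅` form two chains. -/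
theorem IsSplitPartition.exists_two_chains {V : Type*} [Finite V] {G : SimpleGraph V} {C S : Set V}
    (h : IsSplitPartition G C S) (hg : ¬ gem.IsIndContained G) (h5 : ¬ graphS5.IsIndContained G) :
    ∃ L : V → Prop, ∀ s ∈ S, ∀ t ∈ S, IsBranching G S s → IsBranching G S t → (L s ↔ L t) →
      G.neighborSet s ⊆ G.neighborSet t ∨ G.neighborSet t ⊆ G.neighborSet s := by
  by_cases hex : ∃ s ∈ S, IsBranching G S s
  · obtain ⟨b, ⟨hb, hbr⟩, hmin⟩ := Set.exists_min_image {s | s ∈ S ∧ IsBranching G S s}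
      (fun s => (G.neighborSet s).ncard) (Set.toFinite _) hex
    have hbne : ∃ e, G.Adj b e := by
      obtain ⟨a, -, -, -, h1, -, ⟨e, he⟩, -⟩ := hbr
      exact ⟨e, h1 he⟩
    have hsub : ∀ s ∈ S, IsBranching G S s → (∃ e, G.Adj s e ∧ G.Adj b e) →
        G.neighborSet b ⊆ G.neighborSet s := by
      intro s hs hsbr he
      rcases h.neighborSet_laminar hg hs hb he with h1 | h1
      · exact (Set.eq_of_subset_of_ncard_le h1 (hmin s ⟨hs, hsbr⟩) (Set.toFinite _)).ge
      · exact h1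
    -- With `b` a branching vertex of smallest neighbourhood, those meeting it all contain it, hence
    -- meet each other. Two that avoid it must meet, or they and `b` would yield `graphS5`.
    refine ⟨fun s => ∃ e, G.Adj s e ∧ G.Adj b e, fun s hs t ht hsbr htbr hst => ?_⟩
    apply h.neighborSet_laminar hg hs ht
    by_cases hL : ∃ e, G.Adj s e ∧ G.Adj b e
    · obtain ⟨e, he⟩ := hbne
      exact ⟨e, hsub s hs hsbr hL he, hsub t ht htbr (hst.1 hL) he⟩
    · have hL' := mt hst.2 hL
      push Not at hL hL'
      by_contra hdis
      push Not at hdis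
      refine h5 (h.graphS5_isIndContained ![b, s, t] ?_ ?_ ?_)
      · intro i; fin_cases i <;> simp [hb, hs, ht]
      · intro i; fin_cases i <;> simp [hbr, hsbr, htbr]
      · intro i j hij e
        have := hL e
        have := hL' e
        have := hdis e
        fin_cases i <;> fin_cases j <;> simp at hij ⊢ <;> tauto
  · refine ⟨fun _ => True, fun s hs t _ hsbr => ?_⟩
    exact absurd ⟨s, hs, hsbr⟩ hex

/-! ### Construction of a representation -/

open Classical in
/-- A representation in which the paths of the clique share a row, and the paths of the
stable set have two grid edges each. -/
theorem IsSplitPartition.isLGraph_of_corners {V : Type*} {G : SimpleGraph V} {C S : Set V}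
    (h : IsSplitPartition G C S) (x r t : V → ℤ) (m : ℤ) (hx : ∀ c ∈ C, x c ≤ m)
    (hr : ∀ c ∈ C, m < r c) (ht : ∀ c ∈ C, 0 < t c) (p q : V → ℤ)
    (hpq : ∀ s ∈ S, ∀ s' ∈ S, p s = p s' → q s = q s' → s = s')
    (hadj : ∀ s ∈ S, ∀ c ∈ C, G.Adj s c ↔
      (q s = 0 ∧ x c ≤ p s ∧ p s < r c) ∨ (p s = x c ∧ 0 ≤ q s ∧ q s < t c)) : IsLGraph G := by
  refine ⟨fun v => if hv : v ∈ C then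
    ⟨x v, 0, r v, t v, (hx v hv).trans_lt (hr v hv), ht v hv⟩
    else ⟨p v, q v, p v + 1, q v + 1, by omega, by omega⟩, fun u v huv => ?_⟩
  rw [LPath.edges_inter_nonempty_iff]
  rcases h.mem_or_mem u with hu | hu <;> rcases h.mem_or_mem v with hv | hv
  · have := hx u hu
    have := hx v hv
    have := hr u hu
    have := hr v hv
    simp only [hu, hv, dif_pos, h.clique hu hv huv, true_iff]
    exact .inl ⟨trivial, by omega, by omega⟩
  · have hv' := h.not_mem_left hv
    simp only [hu, hv', dif_pos, dif_neg, not_false_iff]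
    rw [G.adj_comm, hadj v hv u hu]
    omega
  · have hu' := h.not_mem_left hu
    simp only [hv, hu', dif_pos, dif_neg, not_false_iff]
    rw [hadj u hu v hv]
    omega
  · have hu' := h.not_mem_left hu
    have hv' := h.not_mem_left hv
    simp only [hu', hv', dif_neg, not_false_iff, h.not_adj hu hv, false_iff]
    intro hc
    have h1 : p u = p v := by omega
    have h2 : q u = q v := by omega
    exact huv (hpq u hu v hv h1 h2)

/-- Vertices are listed by decreasing degree, ties being broken by an enumeration. Along a chain the
neighbours of `c` then form an initial segment, so one threshold per `c` encodes its adjacencies. -/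
theorem SimpleGraph.exists_index_antitone {V : Type*} [Finite V] (G : SimpleGraph V) :
    ∃ (i : V → ℕ) (B : ℕ), Function.Injective i ∧ (∀ s, i s < B) ∧
      ∀ s t, G.neighborSet s ⊆ G.neighborSet t → i s < i t →
        G.neighborSet s = G.neighborSet t := by
  obtain ⟨n, ⟨e⟩⟩ := Finite.exists_equiv_fin V
  have hcard : ∀ s, (G.neighborSet s).ncard ≤ n := fun s => by
    have := Set.ncard_le_ncard (Set.subset_univ (G.neighborSet s))
    rwa [Set.ncard_univ, Nat.card_congr e, Nat.card_fin] at this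
  refine ⟨fun s => (n - (G.neighborSet s).ncard) * n + e s, (n + 1) * n, fun s t hst => ?_,
    fun s => ?_, fun s t hst hi => ?_⟩
  · have := congrArg (· % n) hst
    simp only [Nat.mul_add_mod_self_right, Nat.mod_eq_of_lt (e _).2] at this
    exact e.injective (Fin.ext this)
  · have := (e s).2
    have : (n - (G.neighborSet s).ncard) * n ≤ n * n := Nat.mul_le_mul_right n (by omega)
    simp only [add_mul, one_mul]
    omega
  · refine Set.eq_of_subset_of_ncard_le hst ?_
    by_contra hlt
    have h1 := hcard t
    have h2 : (n - (G.neighborSet t).ncard + 1) * n ≤ (n - (G.neighborSet s).ncard) * n :=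
      Nat.mul_le_mul_right n (by omega)
    have := (e t).2
    simp only [add_mul, one_mul] at h2 hi
    omega

/-- `c` and `d` are equal or neighbours of a common non-branching vertex of `S`. -/
def SameColumn {V : Type*} (G : SimpleGraph V) (S : Set V) (c d : V) : Prop :=
  c = d ∨ ∃ s ∈ S, ¬ IsBranching G S s ∧ G.Adj s c ∧ G.Adj s d

/-- Transitivity is laminarity: two neighbourhoods sharing the middle vertex are nested, and the
larger joins the outer two. -/
theorem IsSplitPartition.exists_column_index {V : Type*} [Finite V] {G : SimpleGraph V}
    {C S : Set V} (h : IsSplitPartition G C S) (hg : ¬ gem.IsIndContained G) :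
    ∃ (col : V → ℕ) (K : ℕ), (∀ c, col c < K) ∧ ∀ c d, col c = col d ↔ SameColumn G S c d := by
  let r : Setoid V := ⟨SameColumn G S, fun c => .inl rfl, by
    rintro c d (rfl | ⟨s, hs, hbr, hc, hd⟩)
    · exact .inl rfl
    · exact .inr ⟨s, hs, hbr, hd, hc⟩, by
    rintro c d e (rfl | ⟨s, hs, hbr, hc, hd⟩) (rfl | ⟨t, ht, hbr', hd', he⟩)
    · exact .inl rfl
    · exact .inr ⟨t, ht, hbr', hd', he⟩
    · exact .inr ⟨s, hs, hbr, hc, hd⟩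
    · rcases h.neighborSet_laminar hg hs ht ⟨d, hd, hd'⟩ with hst | hst
      · exact .inr ⟨t, ht, hbr', hst hc, he⟩
      · exact .inr ⟨s, hs, hbr, hc, hst he⟩⟩
  obtain ⟨K, ⟨e⟩⟩ := Finite.exists_equiv_fin (Quotient r)
  refine ⟨fun c => e (Quotient.mk r c), K, fun c => (e _).2, fun c d => ?_⟩
  rw [Fin.val_inj, e.apply_eq_iff_eq, Quotient.eq]
  rfl

open Classical in
/-- One more than the largest index of a vertex in `p` which is adjacent to `c`. -/
theorem exists_height {V : Type*} [Finite V] (G : SimpleGraph V) (i : V → ℕ) (p : V → Prop) :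
    ∃ f : V → ℕ, ∀ c m, m < f c ↔ ∃ s, p s ∧ G.Adj s c ∧ m ≤ i s := by
  cases nonempty_fintype V
  refine ⟨fun c => (Finset.univ.filter fun s => p s ∧ G.Adj s c).sup fun s => i s + 1,
    fun c m => ?_⟩
  simp only [Finset.lt_sup_iff, Finset.mem_filter, Finset.mem_univ, true_and, Nat.lt_succ_iff,
    and_assoc]

open Classical in
theorem IsSplitPartition.isLGraph {V : Type*} [Finite V] {G : SimpleGraph V}
    {C S : Set V} (h : IsSplitPartition G C S) (hg : ¬ gem.IsIndContained G)
    (h5 : ¬ graphS5.IsIndContained G) : IsLGraph G := by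
  obtain ⟨L, hL⟩ := h.exists_two_chains hg h5
  obtain ⟨i, B, hinj, hB, hi⟩ := G.exists_index_antitone
  obtain ⟨col, K, hcolK, hcol⟩ := h.exists_column_index hg
  obtain ⟨hl, hhl⟩ := exists_height G i fun s => s ∈ S ∧ IsBranching G S s ∧ L s
  obtain ⟨hr, hhr⟩ := exists_height G i fun s => s ∈ S ∧ IsBranching G S s ∧ ¬ L s
  obtain ⟨hk, hhk⟩ := exists_height G i fun s => s ∈ S ∧ ¬ IsBranching G S s
  -- the heights of `c` determine its adjacencies within a chain
  have hchain : ∀ s t c, (G.neighborSet s ⊆ G.neighborSet t ∨ G.neighborSet t ⊆ G.neighborSet s) →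
      G.Adj t c → i s ≤ i t → G.Adj s c := by
    intro s t c hst htc hle
    rcases hst with hst | hst
    · rcases hle.lt_or_eq with hlt | heq
      · have : c ∈ G.neighborSet t := htc
        rwa [← hi s t hst hlt] at this
      · rwa [hinj heq]
    · exact hst htc
  have hlB : ∀ c, hl c ≤ B := by
    intro c
    by_contra hc
    obtain ⟨s, -, -, hs⟩ := (hhl c B).1 (by omega)
    exact absurd (hB s) (by omega)
  have hl_iff : ∀ s ∈ S, IsBranching G S s → L s → ∀ c, G.Adj s c ↔ i s < hl c := by
    intro s hs hbr hLs c
    rw [hhl]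
    refine ⟨fun hc => ⟨s, ⟨hs, hbr, hLs⟩, hc, le_rfl⟩, ?_⟩
    rintro ⟨t, ⟨ht, htbr, hLt⟩, htc, hle⟩
    exact hchain s t c (hL s hs t ht hbr htbr (by simp [hLs, hLt])) htc hle
  have hr_iff : ∀ s ∈ S, IsBranching G S s → ¬ L s → ∀ c, G.Adj s c ↔ i s < hr c := by
    intro s hs hbr hLs c
    rw [hhr]
    refine ⟨fun hc => ⟨s, ⟨hs, hbr, hLs⟩, hc, le_rfl⟩, ?_⟩
    rintro ⟨t, ⟨ht, htbr, hLt⟩, htc, hle⟩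
    exact hchain s t c (hL s hs t ht hbr htbr (by simp [hLs, hLt])) htc hle
  have hk_iff : ∀ s ∈ S, ¬ IsBranching G S s → ∀ d, G.Adj s d →
      ∀ c, G.Adj s c ↔ col d = col c ∧ i s < hk c := by
    intro s hs hbr d hd c
    rw [hcol, hhk]
    refine ⟨fun hc => ⟨.inr ⟨s, hs, hbr, hd, hc⟩, s, ⟨hs, hbr⟩, hc, le_rfl⟩, ?_⟩
    rintro ⟨rfl | ⟨u, hu, hubr, hud, huc⟩, t, ⟨ht, htbr⟩, htc, hle⟩
    · exact hd
    rcases h.neighborSet_laminar hg hu hs ⟨d, hud, hd⟩ with hus | hus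
    · exact hus huc
    refine hchain s t c (h.neighborSet_laminar hg hs ht ?_) htc hle
    rcases h.neighborSet_laminar hg hu ht ⟨c, huc, htc⟩ with hut | hut
    · exact ⟨d, hd, hut hud⟩
    -- Disjoint neighbourhoods of `s` and `t` inside that of `u` would make `u` branching.
    · by_contra hdis
      push Not at hdis
      exact hubr ⟨s, hs, t, ht, hus, hut, ⟨d, hd⟩, ⟨c, htc⟩, fun e he => hdis e he.1 he.2⟩
  -- A branching neighbourhood that meets a non-branching one contains it, so it is a union of
  -- columns up to vertices outside any shared column; the left threshold is constant on a column.
  have hl_col : ∀ c d, col c = col d → hl c = hl d := by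
    have key : ∀ c d, col c = col d → hl c ≤ hl d := by
      intro c d hcd
      refine le_of_forall_lt fun m hm => ?_
      rw [hhl] at hm ⊢
      obtain ⟨t, ⟨ht, htbr, hLt⟩, htc, hle⟩ := hm
      refine ⟨t, ⟨ht, htbr, hLt⟩, ?_, hle⟩
      rcases (hcol c d).1 hcd with rfl | ⟨s, hs, hbr, hsc, hsd⟩
      · exact htc
      rcases h.neighborSet_laminar hg hs ht ⟨c, hsc, htc⟩ with hst | hst
      · exact hst hsd
      · exact absurd (htbr.mono hst) hbr
    exact fun c d hcd => le_antisymm (key c d hcd) (key d c hcd.symm)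
  -- Blocks of `K` positions are ordered by decreasing left height; within a block the residue
  -- modulo `K` is the column.
  let x : V → ℤ := fun c => K * (B - hl c) + col c
  have hx_col : ∀ c d, x c = x d ↔ col c = col d := by
    intro c d
    constructor
    · intro hcd
      have := congrArg (· % (K : ℤ)) hcd
      simp only [x, Int.mul_add_emod_self_left] at this
      rw [Int.emod_eq_of_lt (by omega) (by exact_mod_cast hcolK c),
        Int.emod_eq_of_lt (by omega) (by exact_mod_cast hcolK d)] at this
      exact_mod_cast this
    · intro hcd
      simp only [x, hcd, hl_col c d hcd]
  let m : ℤ := K * (B + 1)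
  have hxm : ∀ c, x c ≤ m := by
    intro c
    have h1 := hcolK c
    have h2 : (0 : ℤ) ≤ K * hl c := by positivity
    simp only [x, m, mul_sub, mul_add, mul_one]
    omega
  have hex : ∀ s, ∃ d, (∃ c, G.Adj s c) → G.Adj s d := by
    intro s
    by_cases hs : ∃ c, G.Adj s c
    · exact ⟨hs.choose, fun _ => hs.choose_spec⟩
    · exact ⟨s, fun h' => absurd h' hs⟩
  choose d hd using hex
  -- Left chain: the last edge before the block of height `i s`. Right chain: beyond the common edge
  -- at `m`. Non-branching: in the column, above row 0. Isolated: below row 0, out of reach.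
  let p : V → ℤ := fun s => if ∃ c, G.Adj s c then
    if IsBranching G S s then if L s then K * (B - i s) - 1 else m + 1 + i s else x (d s) else 0
  let q : V → ℤ := fun s => if ∃ c, G.Adj s c then
    if IsBranching G S s then 0 else 1 + i s else -1 - i s
  have hleft : ∀ s, (K : ℤ) * (B - i s) ≤ m := by
    intro s
    have h2 : (0 : ℤ) ≤ K * i s := by positivity
    have h3 : (0 : ℤ) ≤ K := by positivity
    simp only [m, mul_sub, mul_add, mul_one]
    omega
  refine h.isLGraph_of_corners x (fun c => m + 1 + hr c) (fun c => 1 + hk c) m (fun c _ => hxm c)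
    (fun c _ => by omega) (fun c _ => by omega) p q ?_ ?_
  · intro s hs t ht hp hq
    simp only [p, q] at hp hq
    apply hinj
    have h1 := hleft s
    have h2 := hleft t
    have hK : 0 < K := (Nat.zero_le _).trans_lt (hcolK s)
    have h3 : (K : ℤ) * (B - i s) = K * (B - i t) → i s = i t := by
      intro he
      have := mul_left_cancel₀ (by exact_mod_cast hK.ne') he
      omega
    split_ifs at hp hq <;> omega
  · intro s hs c hc
    have h0 := hxm c
    simp only [p, q]
    split_ifs with hne hbr hLs
    · rw [hl_iff s hs hbr hLs]
      have h1 := hcolK c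
      have h2 := hleft s
      have h3 : x c < K * (B - i s) ↔ i s < hl c := by
        constructor
        · intro hlt
          by_contra hge
          have : (K : ℤ) * (B - i s) ≤ K * (B - hl c) :=
            mul_le_mul_of_nonneg_left (by omega) (by positivity)
          simp only [x] at hlt
          omega
        · intro hlt
          have : (K : ℤ) * (B - hl c) ≤ K * (B - i s - 1) :=
            mul_le_mul_of_nonneg_left (by omega) (by positivity)
          rw [mul_sub _ _ (1 : ℤ), mul_one] at this
          simp only [x]
          omega
      rw [← h3]
      omega
    · rw [hr_iff s hs hbr hLs]
      omega
    · rw [hk_iff s hs hbr (d s) (hd s hne) c, ← hx_col]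
      omega
    · have : ¬ G.Adj s c := fun hsc => hne ⟨c, hsc⟩
      simp only [this, false_iff]
      omega

/-! ### Forbidden subgraphs of split graphs -/

/-- The graph `2K₂`: two disjoint edges. -/
def twoEdges : SimpleGraph (Fin 4) := SimpleGraph.fromEdgeSet {s(0, 1), s(2, 3)}

/-- The cycle with four vertices. -/
def fourCycle : SimpleGraph (Fin 4) := SimpleGraph.fromEdgeSet {s(0, 1), s(1, 2), s(2, 3), s(3, 0)}

/-- The cycle with five vertices. -/
def fiveCycle : SimpleGraph (Fin 5) :=
  SimpleGraph.fromEdgeSet {s(0, 1), s(1, 2), s(2, 3), s(3, 4), s(4, 0)}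

theorem IsSplitGraph.of_isIndContained {V W : Type*} {H : SimpleGraph W} {G : SimpleGraph V}
    (h : IsSplitGraph G) (hH : H.IsIndContained G) : IsSplitGraph H := by
  obtain ⟨C, S, hCS⟩ := h
  obtain ⟨f⟩ := hH
  refine ⟨f ⁻¹' C, f ⁻¹' S, ?_, hCS.disj.preimage f, ?_, ?_⟩
  · rw [← Set.preimage_union, hCS.cover, Set.preimage_univ]
  · exact fun u hu v hv huv => f.map_adj_iff.1 (hCS.clique hu hv (f.injective.ne huv))
  · exact fun u hu v hv huv h' => hCS.stable hu hv (f.injective.ne huv) (f.map_adj_iff.2 h')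

theorem not_isSplitGraph_twoEdges : ¬ IsSplitGraph twoEdges := by
  rintro ⟨C, S, h⟩
  have h1 := fun v => h.mem_or_mem v
  have h2 := fun u v (hu : u ∈ C) (hv : v ∈ C) => h.clique hu hv
  have h3 := fun u v (hu : u ∈ S) (hv : v ∈ S) => h.not_adj hu hv
  simp only [twoEdges, SimpleGraph.fromEdgeSet_adj] at h2 h3
  have a := h2 0 2
  have b := h2 0 3
  have c := h2 1 2
  have d := h2 1 3
  have e := h3 0 1
  have f := h3 2 3
  simp at a b c d e f
  have := h1 0
  have := h1 1
  have := h1 2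
  have := h1 3
  grind

theorem not_isSplitGraph_fourCycle : ¬ IsSplitGraph fourCycle := by
  rintro ⟨C, S, h⟩
  have h1 := fun v => h.mem_or_mem v
  have h2 := fun u v (hu : u ∈ C) (hv : v ∈ C) => h.clique hu hv
  have h3 := fun u v (hu : u ∈ S) (hv : v ∈ S) => h.not_adj hu hv
  simp only [fourCycle, SimpleGraph.fromEdgeSet_adj] at h2 h3
  have a := h2 0 2
  have b := h2 1 3
  have c := h3 0 1
  have d := h3 1 2
  have e := h3 2 3
  have f := h3 3 0
  simp at a b c d e f
  have := h1 0
  have := h1 1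
  have := h1 2
  have := h1 3
  grind

theorem not_isSplitGraph_fiveCycle : ¬ IsSplitGraph fiveCycle := by
  rintro ⟨C, S, h⟩
  have h1 := fun v => h.mem_or_mem v
  have h2 := fun u v (hu : u ∈ C) (hv : v ∈ C) => h.clique hu hv
  have h3 := fun u v (hu : u ∈ S) (hv : v ∈ S) => h.not_adj hu hv
  simp only [fiveCycle, SimpleGraph.fromEdgeSet_adj] at h2 h3
  have a := h2 0 2
  have b := h2 1 3
  have c := h2 2 4
  have d := h2 3 0
  have e := h2 4 1
  have a' := h3 0 1
  have b' := h3 1 2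
  have c' := h3 2 3
  have d' := h3 3 4
  have e' := h3 4 0
  simp at a b c d e a' b' c' d' e'
  have := h1 0
  have := h1 1
  have := h1 2
  have := h1 3
  have := h1 4
  grind

section
variable {V : Type*} {G : SimpleGraph V}

theorem SimpleGraph.IsIndContained.of_lt {n : ℕ} {H : SimpleGraph (Fin n)}
    (f : Fin n → V) (hf : ∀ i j, i < j → f i ≠ f j ∧ (G.Adj (f i) (f j) ↔ H.Adj i j)) :
    H.IsIndContained G := by
  refine ⟨⟨⟨f, fun i j hij => ?_⟩, fun {i j} => ?_⟩⟩
  · rcases lt_trichotomy i j with h | h | h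
    · exact absurd hij (hf i j h).1
    · exact h
    · exact absurd hij.symm (hf j i h).1
  · change G.Adj (f i) (f j) ↔ H.Adj i j
    rcases lt_trichotomy i j with h | rfl | h
    · exact (hf i j h).2
    · simp
    · rw [G.adj_comm, H.adj_comm]
      exact (hf j i h).2

theorem twoEdges_isIndContained {a b c d : V} (hab : G.Adj a b) (hcd : G.Adj c d)
    (hac : ¬ G.Adj a c) (had : ¬ G.Adj a d) (hbc : ¬ G.Adj b c) (hbd : ¬ G.Adj b d) :
    twoEdges.IsIndContained G := by
  have h1 : a ≠ c := by rintro rfl; exact had hcd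
  have h2 : a ≠ d := by rintro rfl; exact hac hcd.symm
  have h3 : b ≠ c := by rintro rfl; exact hbd hcd
  have h4 : b ≠ d := by rintro rfl; exact hbc hcd.symm
  refine .of_lt ![a, b, c, d] fun i j hij => ?_
  fin_cases i <;> fin_cases j <;> first
    | exact absurd hij (by decide)
    | simp [twoEdges, hab, hcd, hac, had, hbc, hbd, h1, h2, h3, h4, hab.ne, hcd.ne]

theorem fourCycle_isIndContained {a b c d : V} (hab : G.Adj a b) (hbc : G.Adj b c)
    (hcd : G.Adj c d) (hda : G.Adj d a) (hac : ¬ G.Adj a c) (hbd : ¬ G.Adj b d) (h1 : a ≠ c)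
    (h2 : b ≠ d) : fourCycle.IsIndContained G := by
  refine .of_lt ![a, b, c, d] fun i j hij => ?_
  fin_cases i <;> fin_cases j <;> first
    | exact absurd hij (by decide)
    | simp [fourCycle, hab, hcd, hbc, hda.symm, hac, hbd, h1, h2, hab.ne, hcd.ne, hbc.ne,
        hda.ne.symm]

theorem fiveCycle_isIndContained {a b c d e : V} (hab : G.Adj a b) (hbc : G.Adj b c)
    (hcd : G.Adj c d) (hde : G.Adj d e) (hea : G.Adj e a) (hac : ¬ G.Adj a c) (hbd : ¬ G.Adj b d)
    (hce : ¬ G.Adj c e) (hda : ¬ G.Adj d a) (heb : ¬ G.Adj e b) : fiveCycle.IsIndContained G := by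
  have h1 : a ≠ c := by rintro rfl; exact hda hcd.symm
  have h2 : b ≠ d := by rintro rfl; exact heb hde.symm
  have h3 : c ≠ e := by rintro rfl; exact hac hea.symm
  have h4 : a ≠ d := by rintro rfl; exact hbd hab.symm
  have h5 : b ≠ e := by rintro rfl; exact hce hbc.symm
  refine .of_lt ![a, b, c, d, e] fun i j hij => ?_
  rw [G.adj_comm] at hda heb
  fin_cases i <;> fin_cases j <;> first
    | exact absurd hij (by decide)
    | simp [fiveCycle, hab, hcd, hbc, hde, hea.symm, hac, hbd, hce, hda, heb, h1, h2, h3, h4, h5,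
        hab.ne, hcd.ne, hbc.ne, hde.ne, hea.ne.symm]

open Classical in
-- Maximize the sum of degree plus one: the extra one makes every extension a gain, and exchanging
-- `u` for `x` cannot raise the degree.
theorem exists_clique_max_degree [Fintype V] (G : SimpleGraph V) :
    ∃ C : Finset V, G.IsClique (C : Set V) ∧
      (∀ x ∉ C, ∃ u ∈ C, ¬ G.Adj x u) ∧
      ∀ x ∉ C, ∀ u ∈ C, (∀ w ∈ C, w ≠ u → G.Adj x w) → G.degree x ≤ G.degree u := by
  obtain ⟨C, hC, hmax⟩ := Set.exists_max_image {C : Finset V | G.IsClique (C : Set V)}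
    (fun C => ∑ c ∈ C, (G.degree c + 1)) (Set.toFinite _) ⟨∅, by simp⟩
  refine ⟨C, hC, fun x hx => ?_, fun x hx u hu hxu => ?_⟩
  · by_contra hc
    push Not at hc
    have := hmax (insert x C) (by
      simp only [Finset.coe_insert, Set.mem_ofPred_eq]
      exact hC.insert fun b hb _ => hc b hb)
    rw [Finset.sum_insert hx] at this
    omega
  · have := hmax (insert x (C.erase u)) (by
      simp only [Finset.coe_insert, Set.mem_ofPred_eq]
      refine SimpleGraph.IsClique.insert (hC.subset (by simp)) fun b hb _ => ?_
      simp only [Finset.coe_erase, Set.mem_sdiff, Finset.mem_coe, Set.mem_singleton_iff] at hb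
      exact hxu b hb.1 hb.2)
    rw [Finset.sum_insert (by simp [hx]), ← Finset.add_sum_erase C _ hu] at this
    omega

/-- A graph without induced `2K₂`, `C₄` and `C₅` is a split graph. -/
theorem isSplitGraph_of_forbidden [Finite V] (h2 : ¬ twoEdges.IsIndContained G)
    (h4 : ¬ fourCycle.IsIndContained G) (h5 : ¬ fiveCycle.IsIndContained G) : IsSplitGraph G := by
  classical
  cases nonempty_fintype V
  obtain ⟨C, hC, hmax, hdeg⟩ := exists_clique_max_degree G
  refine ⟨C, (C : Set V)ᶜ, Set.union_compl_self _, disjoint_compl_right, hC, ?_⟩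
  -- the non-neighbours of `x` in `C` can be assumed to be non-neighbours of `y`
  have main : ∀ x ∉ C, ∀ y ∉ C, G.Adj x y → (∀ u ∈ C, ¬ G.Adj x u → ¬ G.Adj y u) → False := by
    intro x hx y hy hxy hsub
    obtain ⟨u, hu, hxu⟩ := hmax x hx
    have hyu := hsub u hu hxu
    have honly : ∀ w ∈ C, w ≠ u → G.Adj x w := by
      intro w hw hwu
      by_contra hxw
      exact h2 (twoEdges_isIndContained hxy (hC hw hu hwu) hxw hxu (hsub w hw hxw) hyu)
    have hle := hdeg x hx u hu honly
    -- `y` is a neighbour of `x` but not of `u`, so the degree bound forces a neighbour of `u` that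
    -- `x` misses.
    obtain ⟨z, hz, hxz⟩ : ∃ z, G.Adj u z ∧ ¬ G.Adj x z := by
      by_contra hc
      push Not at hc
      have hss : G.neighborFinset u ⊂ G.neighborFinset x := by
        rw [Finset.ssubset_iff_of_subset fun z hz => by simpa using hc z (by simpa using hz)]
        exact ⟨y, by simpa using hxy, by simpa [G.adj_comm u y] using hyu⟩
      have := Finset.card_lt_card hss
      rw [G.card_neighborFinset_eq_degree, G.card_neighborFinset_eq_degree] at this
      omega
    have hzC : z ∉ C := fun hzC => hxz (honly z hzC hz.ne')
    have hyz : G.Adj y z := by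
      by_contra hyz
      exact h2 (twoEdges_isIndContained hxy hz hxu hxz hyu hyz)
    obtain ⟨w, hw, hzw⟩ := hmax z hzC
    have hwu : w ≠ u := by rintro rfl; exact hzw hz.symm
    have huw : G.Adj u w := hC hu hw hwu.symm
    have hxw := honly w hw hwu
    by_cases hyw : G.Adj y w
    · refine h4 (fourCycle_isIndContained hyz hz.symm huw hyw.symm hyu hzw ?_ ?_)
      · rintro rfl; exact hy hu
      · rintro rfl; exact hzC hw
    · exact h5 (fiveCycle_isIndContained hxy hyz hz.symm huw hxw.symm hxz hyu hzw
        (fun h => hxu h.symm) (fun h => hyw h.symm))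
  intro x hx y hy _ hxy
  simp only [Set.mem_compl_iff, Finset.mem_coe] at hx hy
  by_cases hsub : ∀ u ∈ C, ¬ G.Adj x u → ¬ G.Adj y u
  · exact main x hx y hy hxy hsub
  refine main y hy x hx hxy.symm fun v hv hyv hxv => ?_
  push Not at hsub
  obtain ⟨u, hu, hxu, hyu⟩ := hsub
  -- If the non-neighbours in `C` were incomparable, `x, y, u, v` would be an induced 4-cycle.
  have huv : u ≠ v := by rintro rfl; exact hyv hyu
  refine h4 (fourCycle_isIndContained hxy hyu (hC hu hv huv) hxv.symm hxu hyv ?_ ?_)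
  · rintro rfl; exact hx hu
  · rintro rfl; exact hy hv

theorem isSplitGraph_iff [Finite V] : IsSplitGraph G ↔ ¬ twoEdges.IsIndContained G ∧
    ¬ fourCycle.IsIndContained G ∧ ¬ fiveCycle.IsIndContained G :=
  ⟨fun h => ⟨fun h' => not_isSplitGraph_twoEdges (h.of_isIndContained h'),
    fun h' => not_isSplitGraph_fourCycle (h.of_isIndContained h'),
    fun h' => not_isSplitGraph_fiveCycle (h.of_isIndContained h')⟩,
    fun ⟨h2, h4, h5⟩ => isSplitGraph_of_forbidden h2 h4 h5⟩

end

/-! ### First-order properties are recognizable in polynomial time -/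

/-- `p`, started with register contents `R`, halts within `T` steps with register contents that
satisfy `Q`. -/
def RamProg.Runs (A : ℕ → ℕ → ℕ) (p : RamProg) (R : ℕ → ℕ) (T : ℕ) (Q : (ℕ → ℕ) → Prop) : Prop :=
  ∃ t R', RamExec A p R t R' ∧ t ≤ T ∧ Q R'

namespace RamProg.Runs

variable {A : ℕ → ℕ → ℕ} {p q : RamProg} {R : ℕ → ℕ} {T T' : ℕ} {Q Q' : (ℕ → ℕ) → Prop}

theorem mono (h : p.Runs A R T Q) (hT : T ≤ T') (hQ : ∀ R', Q R' → Q' R') : p.Runs A R T' Q' := by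
  obtain ⟨t, R', h1, h2, h3⟩ := h
  exact ⟨t, R', h1, h2.trans hT, hQ _ h3⟩

theorem seq (hp : p.Runs A R T Q) (hq : ∀ R', Q R' → q.Runs A R' T' Q') :
    (RamProg.seq p q).Runs A R (T + T') Q' := by
  obtain ⟨t, R', h1, h2, h3⟩ := hp
  obtain ⟨t', R'', h1', h2', h3'⟩ := hq R' h3
  exact ⟨_, R'', .seq h1 h1', by omega, h3'⟩

theorem cond {a : ℕ} (hp : R a ≠ 0 → p.Runs A R T Q) (hq : R a = 0 → q.Runs A R T Q) :
    (RamProg.cond a p q).Runs A R (T + 1) Q := by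
  by_cases ha : R a = 0
  · obtain ⟨t, R', h1, h2, h3⟩ := hq ha
    exact ⟨_, R', .cond_false ha h1, by omega, h3⟩
  · obtain ⟨t, R', h1, h2, h3⟩ := hp ha
    exact ⟨_, R', .cond_true ha h1, by omega, h3⟩

theorem const {d k : ℕ} (h : Q (Function.update R d k)) : (RamProg.const d k).Runs A R 1 Q :=
  ⟨1, _, .const d k R, le_rfl, h⟩

theorem add {d a b : ℕ} (h : Q (Function.update R d (R a + R b))) :
    (RamProg.add d a b).Runs A R 1 Q :=
  ⟨1, _, .add d a b R, le_rfl, h⟩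

theorem sub {d a b : ℕ} (h : Q (Function.update R d (R a - R b))) :
    (RamProg.sub d a b).Runs A R 1 Q :=
  ⟨1, _, .sub d a b R, le_rfl, h⟩

theorem query {d a b : ℕ} (h : Q (Function.update R d (A (R a) (R b)))) :
    (RamProg.query d a b).Runs A R 1 Q :=
  ⟨1, _, .query d a b R, le_rfl, h⟩

/-- A loop whose counter `a` decreases by one in each round. -/
theorem loop {a : ℕ} (hp : ∀ R, Q R → R a ≠ 0 → p.Runs A R T fun R' => Q R' ∧ R' a = R a - 1)
    (m : ℕ) : ∀ R, Q R → R a = m →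
      (RamProg.loop a p).Runs A R (m * (T + 1) + 1) fun R' => Q R' ∧ R' a = 0 := by
  induction m with
  | zero => exact fun R hR ha => ⟨1, R, .loop_false ha, by omega, hR, ha⟩
  | succ m ih =>
    intro R hR ha
    obtain ⟨t, R', h1, h2, h3, h4⟩ := hp R hR (by omega)
    obtain ⟨t', R'', h1', h2', h3'⟩ := ih R' h3 (by omega)
    refine ⟨_, R'', .loop_true (by omega) h1 h1', ?_, h3'⟩
    rw [Nat.succ_mul]
    omega

end RamProg.Runs

/-- First-order formulas in the language of graphs, with de Bruijn indices. -/
inductive GraphFormula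
  | adj (i j : ℕ)
  | eq (i j : ℕ)
  | neg (φ : GraphFormula)
  | and (φ ψ : GraphFormula)
  | ex (φ : GraphFormula)

/-- The valuation that maps `0` to `x` and `i + 1` to `σ i`. -/
def consVal (x : ℕ) (σ : ℕ → ℕ) : ℕ → ℕ
  | 0 => x
  | i + 1 => σ i

namespace GraphFormula

/-- The truth value of a formula in the graph with vertices `0, …, n - 1` and adjacency
matrix `A`. -/
def Eval (n : ℕ) (A : ℕ → ℕ → ℕ) : GraphFormula → (ℕ → ℕ) → Prop
  | adj i j, σ => A (σ i) (σ j) ≠ 0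
  | eq i j, σ => σ i = σ j
  | neg φ, σ => ¬ φ.Eval n A σ
  | and φ ψ, σ => φ.Eval n A σ ∧ ψ.Eval n A σ
  | ex φ, σ => ∃ x < n, φ.Eval n A (consVal x σ)

/-- A program that evaluates a formula. The value is stored in register `k`, registers below `k` are
not changed, and the variable `i` is found in register `ρ i`. -/
def compile : GraphFormula → ℕ → (ℕ → ℕ) → RamProg
  | adj i j, k, ρ => .query k (ρ i) (ρ j)
  | eq i j, k, ρ =>
    .seq (.sub k (ρ i) (ρ j)) (.seq (.sub (k + 1) (ρ j) (ρ i)) (.seq (.add k k (k + 1))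
      (.cond k (.const k 0) (.const k 1))))
  | neg φ, k, ρ => .seq (φ.compile k ρ) (.cond k (.const k 0) (.const k 1))
  | and φ ψ, k, ρ => .seq (φ.compile k ρ) (.cond k (ψ.compile k ρ) (.const k 0))
  -- Register `k` accumulates the answer, `k + 1` counts down from `n` and holds the quantified
  -- variable, `k + 2` is scratch; the `add` copies `n` since register `k` is then zero.
  | ex φ, k, ρ =>
    .seq (.const k 0) (.seq (.add (k + 1) 0 k) (.loop (k + 1)
      (.seq (.const (k + 2) 1) (.seq (.sub (k + 1) (k + 1) (k + 2))
        (.seq (φ.compile (k + 2) (consVal (k + 1) ρ))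
          (.cond (k + 2) (.const k 1) (.const (k + 2) 0)))))))

/-- A bound for the running time of the evaluation of a formula. -/
noncomputable def time : GraphFormula → Polynomial ℕ
  | adj _ _ => 1
  | eq _ _ => 5
  | neg φ => φ.time + 2
  | and φ ψ => φ.time + ψ.time + 2
  | ex φ => Polynomial.X * (φ.time + 5) + 3

/-- Induction on the formula. The condition `0 < k` protects register 0, which holds `n`, and `ρ i <
k` protects the variables. -/
theorem compile_runs {n : ℕ} {A : ℕ → ℕ → ℕ} (φ : GraphFormula) :
    ∀ (k : ℕ) (ρ : ℕ → ℕ) (R : ℕ → ℕ), 0 < k → (∀ i, ρ i < k) → R 0 = n →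
      (φ.compile k ρ).Runs A R (φ.time.eval n) fun R' =>
        (∀ i < k, R' i = R i) ∧ (R' k ≠ 0 ↔ φ.Eval n A (R ∘ ρ)) := by
  induction φ with
  | adj i j =>
    intro k ρ R hk hρ hR
    simp only [time, Polynomial.eval_one]
    refine .query ⟨fun l hl => ?_, ?_⟩
    · rw [Function.update_of_ne hl.ne]
    · simp [Eval]
  | eq i j =>
    intro k ρ R hk hρ hR
    have hi := hρ i
    have hj := hρ j
    have h5 : (time (eq i j)).eval n = 1 + (1 + (1 + (1 + 1))) := by simp [time]
    rw [h5]
    refine .seq (Q := fun R' => R' = Function.update R k (R (ρ i) - R (ρ j))) (.sub rfl) ?_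
    rintro _ rfl
    refine .seq (Q := fun R' => (∀ l < k, R' l = R l) ∧ R' k = R (ρ i) - R (ρ j) ∧
      R' (k + 1) = R (ρ j) - R (ρ i)) (.sub ⟨fun l hl => ?_, ?_, ?_⟩) ?_
    · rw [Function.update_of_ne (by omega), Function.update_of_ne (by omega)]
    · rw [Function.update_of_ne (by omega), Function.update_self]
    · rw [Function.update_self, Function.update_of_ne (by omega), Function.update_of_ne (by omega)]
    rintro R₁ ⟨h1, h2, h3⟩
    refine .seq (Q := fun R' => (∀ l < k, R' l = R l) ∧ (R' k = 0 ↔ R (ρ i) = R (ρ j)))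
      (.add ⟨fun l hl => ?_, ?_⟩) ?_
    · rw [Function.update_of_ne (by omega), h1 l hl]
    · rw [Function.update_self]; omega
    rintro R₂ ⟨h1, h2⟩
    refine .cond (fun h => .const ⟨fun l hl => ?_, ?_⟩) (fun h => .const ⟨fun l hl => ?_, ?_⟩)
    · rw [Function.update_of_ne (by omega), h1 l hl]
    · simpa [Eval] using mt h2.2 h
    · rw [Function.update_of_ne (by omega), h1 l hl]
    · simpa [Eval] using h2.1 h
  | neg φ ih =>
    intro k ρ R hk hρ hR
    simp only [time, Polynomial.eval_add, Polynomial.eval_ofNat]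
    refine .seq (T' := 1 + 1) (ih k ρ R hk hρ hR) ?_
    rintro R₁ ⟨h1, h2⟩
    refine .cond (fun h => .const ⟨fun l hl => ?_, ?_⟩) (fun h => .const ⟨fun l hl => ?_, ?_⟩)
    · rw [Function.update_of_ne (by omega), h1 l hl]
    · simpa [Eval] using h2.1 h
    · rw [Function.update_of_ne (by omega), h1 l hl]
    · simpa [Eval] using fun h' => h2.2 h' h
  | and φ ψ ihφ ihψ =>
    intro k ρ R hk hρ hR
    simp only [time, Polynomial.eval_add, Polynomial.eval_ofNat, add_assoc]
    refine .seq (T' := ψ.time.eval n + 1 + 1) (ihφ k ρ R hk hρ hR) ?_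
    rintro R₁ ⟨h1, h2⟩
    have hcomp : R₁ ∘ ρ = R ∘ ρ := funext fun i => h1 _ (hρ i)
    refine .cond (fun h => ?_)
      (fun h => (RamProg.Runs.const ⟨fun l hl => ?_, ?_⟩).mono (by omega) fun _ h => h)
    · refine (ihψ k ρ R₁ hk hρ (by rw [h1 0 hk, hR])).mono (by omega) ?_
      rintro R₂ ⟨h3, h4⟩
      refine ⟨fun l hl => by rw [h3 l hl, h1 l hl], ?_⟩
      rw [h4, hcomp]
      simp only [Eval, h2.1 h, true_and]
    · rw [Function.update_of_ne (by omega), h1 l hl]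
    · have : ¬ φ.Eval n A (R ∘ ρ) := fun h' => h2.2 h' h
      simp [Eval, this]
  | ex φ ih =>
    intro k ρ R hk hρ hR
    have ht : (time (ex φ)).eval n =
        1 + (1 + (n * ((1 + (1 + (φ.time.eval n + (1 + 1)))) + 1) + 1)) := by
      simp only [time, Polynomial.eval_add, Polynomial.eval_mul, Polynomial.eval_X,
        Polynomial.eval_ofNat]
      ring
    rw [ht]
    -- the invariant: the values from `R (k + 1)` on have been tried
    let I : (ℕ → ℕ) → Prop := fun R' => (∀ l < k, R' l = R l) ∧ R' (k + 1) ≤ n ∧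
      (R' k ≠ 0 ↔ ∃ x, R' (k + 1) ≤ x ∧ x < n ∧ φ.Eval n A (consVal x (R ∘ ρ)))
    refine .seq (Q := fun R' => R' = Function.update R k 0) (.const rfl) ?_
    rintro _ rfl
    refine .seq (Q := fun R' => I R' ∧ R' (k + 1) = n) (.add ?_) ?_
    · have h0 : Function.update R k 0 0 = n := by rw [Function.update_of_ne (by omega), hR]
      have h1 : Function.update R k 0 k = 0 := Function.update_self ..
      rw [h0, h1, add_zero]
      refine ⟨⟨fun l hl => ?_, ?_, ?_⟩, ?_⟩
      · rw [Function.update_of_ne (by omega), Function.update_of_ne (by omega)]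
      · rw [Function.update_self]
      · rw [Function.update_self, Function.update_of_ne (by omega), h1]
        simp only [ne_eq, not_true_eq_false, false_iff]
        rintro ⟨x, hx, hx', -⟩
        omega
      · rw [Function.update_self]
    rintro R₁ ⟨hI, hn⟩
    refine (RamProg.Runs.loop (Q := I) ?_ n R₁ hI hn).mono le_rfl ?_
    · rintro R₂ ⟨h1, h2, h3⟩ hne
      refine .seq (Q := fun R' => R' = Function.update R₂ (k + 2) 1) (.const rfl) ?_
      rintro _ rfl
      refine .seq (Q := fun R' => (∀ l < k + 1, R' l = R₂ l) ∧ R' (k + 1) = R₂ (k + 1) - 1)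
        (.sub ⟨fun l hl => ?_, ?_⟩) ?_
      · rw [Function.update_of_ne (by omega), Function.update_of_ne (by omega)]
      · rw [Function.update_self, Function.update_self, Function.update_of_ne (by omega)]
      rintro R₃ ⟨h4, h5⟩
      have hρ' : ∀ i, consVal (k + 1) ρ i < k + 2 := by
        rintro (_ | i)
        · exact Nat.lt_succ_self _
        · exact (hρ i).trans (by omega)
      have hcomp : R₃ ∘ consVal (k + 1) ρ = consVal (R₂ (k + 1) - 1) (R ∘ ρ) := by
        funext i
        cases i with
        | zero => exact h5
        | succ i =>
          have := hρ i
          simp only [Function.comp_apply, consVal]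
          rw [h4 _ (by omega), h1 _ this]
      refine .seq (ih (k + 2) _ R₃ (by omega) hρ'
        (by rw [h4 _ (by omega), h1 _ hk, hR])) ?_
      rintro R₄ ⟨h6, h7⟩
      rw [hcomp] at h7
      have hlow : ∀ l < k, R₄ l = R l := fun l hl => by
        rw [h6 l (by omega), h4 l (by omega), h1 l hl]
      have hk1 : R₄ (k + 1) = R₂ (k + 1) - 1 := by rw [h6 _ (by omega), h5]
      have hk0 : R₄ k = R₂ k := by rw [h6 _ (by omega), h4 _ (by omega)]
      refine .cond (fun h => .const ⟨⟨fun l hl => ?_, ?_, ?_⟩, ?_⟩)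
        (fun h => .const ⟨⟨fun l hl => ?_, ?_, ?_⟩, ?_⟩)
      · rw [Function.update_of_ne (by omega), hlow l hl]
      · rw [Function.update_of_ne (by omega), hk1]
        omega
      · rw [Function.update_self, Function.update_of_ne (by omega), hk1]
        simp only [ne_eq, one_ne_zero, not_false_eq_true, true_iff]
        exact ⟨_, le_rfl, by omega, h7.1 h⟩
      · rw [Function.update_of_ne (by omega), hk1]
      · rw [Function.update_of_ne (by omega), hlow l hl]
      · rw [Function.update_of_ne (by omega), hk1]
        omega
      · rw [Function.update_of_ne (by omega), Function.update_of_ne (by omega), hk1, hk0, h3]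
        constructor
        · rintro ⟨x, hx, hx', hφ⟩
          exact ⟨x, by omega, hx', hφ⟩
        · rintro ⟨x, hx, hx', hφ⟩
          refine ⟨x, ?_, hx', hφ⟩
          by_contra hlt
          obtain rfl : x = R₂ (k + 1) - 1 := by omega
          exact h7.2 hφ h
      · rw [Function.update_of_ne (by omega), hk1]
    · rintro R₂ ⟨⟨h1, h2, h3⟩, h4⟩
      refine ⟨h1, ?_⟩
      rw [h3, h4]
      simp [Eval]

/-- A class of graphs defined by a first-order sentence is recognizable in polynomial time. -/
theorem polyTimeRecognizable (φ : GraphFormula) :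
    PolyTimeRecognizable fun n G => φ.Eval n (adjEntry G) fun _ => n := by
  -- Free variables read register 0. The answer moves from register 1 to register 0 by adding a
  -- zeroed register.
  refine ⟨.seq (φ.compile 1 fun _ => 0) (.seq (.const 2 0) (.add 0 1 2)), φ.time + 2,
    fun n G => ?_⟩
  have h := (compile_runs (n := n) (A := adjEntry G) φ 1 (fun _ => 0) (ramInit n) one_pos
    (fun _ => one_pos) (by simp [ramInit])).seq (T' := 1 + 1)
    (q := .seq (.const 2 0) (.add 0 1 2))
    (Q' := fun R => R 0 ≠ 0 ↔ φ.Eval n (adjEntry G) fun _ => n) (by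
      rintro R₁ ⟨-, h1⟩
      refine .seq (Q := fun R => R = Function.update R₁ 2 0) (.const rfl) ?_
      rintro _ rfl
      refine .add ?_
      rw [Function.update_self, Function.update_self, Function.update_of_ne (by omega), add_zero,
        h1]
      rfl)
  obtain ⟨t, R, h1, h2, h3⟩ := h
  exact ⟨t, R, h1, by rw [Polynomial.eval_add, Polynomial.eval_ofNat]; exact h2, h3⟩

/-! ### Induced subgraphs are first-order definable -/

/-- The formula preceded by `m` quantifiers. -/
def exs (φ : GraphFormula) : ℕ → GraphFormula
  | 0 => φ
  | m + 1 => ex (exs φ m)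

theorem eval_exs {n : ℕ} {A : ℕ → ℕ → ℕ} (φ : GraphFormula) (m : ℕ) : ∀ σ : ℕ → ℕ,
    (φ.exs m).Eval n A σ ↔ ∃ v : ℕ → ℕ, (∀ i < m, v i < n) ∧
      φ.Eval n A fun i => if i < m then v i else σ (i - m) := by
  induction m with
  | zero => simp [exs]
  | succ m ih =>
    intro σ
    simp only [exs, Eval, ih]
    constructor
    · rintro ⟨x, hx, v, hv, h⟩
      -- Under `m` further quantifiers the outermost variable has index `m`.
      refine ⟨fun i => if i = m then x else v i, fun i hi => ?_, ?_⟩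
      · dsimp only
        split_ifs with him
        · exact hx
        · exact hv i (by omega)
      · convert h using 2 with i
        rcases lt_trichotomy i m with him | rfl | him
        · simp [him, him.ne, Nat.lt_succ_of_lt him]
        · simp [consVal]
        · obtain ⟨d, rfl⟩ := Nat.exists_eq_add_of_lt him
          have h1 : m + d + 1 - m = d + 1 := by omega
          have h2 : m + d + 1 - (m + 1) = d := by omega
          rw [if_neg (by omega), if_neg (by omega), h1, h2]
          rfl
    · rintro ⟨v, hv, h⟩
      refine ⟨v m, hv m (by omega), v, fun i hi => hv i (by omega), ?_⟩
      convert h using 2 with i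
      rcases lt_trichotomy i m with him | rfl | him
      · simp [him, Nat.lt_succ_of_lt him]
      · simp [consVal]
      · obtain ⟨d, rfl⟩ := Nat.exists_eq_add_of_lt him
        have h1 : m + d + 1 - m = d + 1 := by omega
        have h2 : m + d + 1 - (m + 1) = d := by omega
        rw [if_neg (by omega), if_neg (by omega), h1, h2]
        rfl

/-- The conjunction of a list of formulas. -/
def conj : List GraphFormula → GraphFormula
  | [] => eq 0 0
  | φ :: l => and φ (conj l)

theorem eval_conj {n : ℕ} {A : ℕ → ℕ → ℕ} {σ : ℕ → ℕ} (l : List GraphFormula) :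
    (conj l).Eval n A σ ↔ ∀ φ ∈ l, φ.Eval n A σ := by
  induction l with
  | nil => simp [conj, Eval]
  | cons φ l ih => simp [conj, Eval, ih]

open Classical in
/-- The variables `i` and `j` are related like the vertices `i` and `j` of `H`. -/
noncomputable def atomicType {m : ℕ} (H : SimpleGraph (Fin m)) (i j : Fin m) : GraphFormula :=
  and (if H.Adj i j then adj i j else neg (adj i j)) (if i = j then eq i j else neg (eq i j))

theorem eval_atomicType {n m : ℕ} {A : ℕ → ℕ → ℕ} {σ : ℕ → ℕ} (H : SimpleGraph (Fin m))
    (i j : Fin m) : (atomicType H i j).Eval n A σ ↔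
      (A (σ i) (σ j) ≠ 0 ↔ H.Adj i j) ∧ (σ i = σ j ↔ i = j) := by
  unfold atomicType
  split_ifs with h1 h2
  · exact absurd h2 h1.ne
  all_goals simp [Eval, *]

/-- The sentence which expresses that `H` is an induced subgraph. -/
noncomputable def contains {m : ℕ} (H : SimpleGraph (Fin m)) : GraphFormula :=
  (conj ((List.finRange m).flatMap fun i => (List.finRange m).map fun j =>
    atomicType H i j)).exs m

theorem adjEntry_ne_zero_iff {n : ℕ} (G : SimpleGraph (Fin n)) (a b : Fin n) :
    adjEntry G a b ≠ 0 ↔ G.Adj a b := by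
  simp [adjEntry]

theorem eval_contains {n m : ℕ} (H : SimpleGraph (Fin m)) (G : SimpleGraph (Fin n)) (σ : ℕ → ℕ) :
    (contains H).Eval n (adjEntry G) σ ↔ H.IsIndContained G := by
  simp only [contains, eval_exs, eval_conj, List.mem_flatMap, List.mem_map, List.mem_finRange,
    true_and, forall_exists_index]
  constructor
  · rintro ⟨v, hv, h⟩
    have h' : ∀ i j : Fin m, (adjEntry G (v i) (v j) ≠ 0 ↔ H.Adj i j) ∧ (v i = v j ↔ i = j) := by
      intro i j
      have := h _ i j rfl
      rw [eval_atomicType] at this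
      simpa using this
    refine ⟨⟨⟨fun i => ⟨v i, hv i i.2⟩, fun i j hij => ?_⟩, fun {i j} => ?_⟩⟩
    · exact (h' i j).2.1 (congrArg Fin.val hij)
    · rw [← (h' i j).1, ← adjEntry_ne_zero_iff]
      rfl
  · rintro ⟨f⟩
    refine ⟨fun i => if hi : i < m then f ⟨i, hi⟩ else 0, fun i hi => ?_, ?_⟩
    · simp [hi]
    · rintro _ i j rfl
      rw [eval_atomicType]
      simp only [Fin.is_lt, if_true, dif_pos, Fin.eta]
      rw [adjEntry_ne_zero_iff, f.map_adj_iff, Fin.val_inj, f.injective.eq_iff]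
      exact ⟨Iff.rfl, Iff.rfl⟩

end GraphFormula

/-! ### The main theorem -/

theorem IsSplitPartition.isLGraph_iff {V : Type*} [Finite V] {G : SimpleGraph V} {C S : Set V}
    (h : IsSplitPartition G C S) (hg : ¬ gem.IsIndContained G) :
    IsLGraph G ↔ ¬ graphS5.IsIndContained G :=
  ⟨fun hL h5 => not_isLGraph_graphS5 (hL.of_isIndContained h5), h.isLGraph hg⟩

theorem polyTimeRecognizable_gemFree_split_isLGraph :
    PolyTimeRecognizable fun _ G => IsSplitGraph G ∧ ¬ gem.IsIndContained G ∧ IsLGraph G := by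
  -- `contains` expects vertices in some `Fin m`, hence the relabelling.
  let H : SimpleGraph (Fin (3 * 5)) := graphS5.comap finProdFinEquiv.symm
  have hH : ∀ {n : ℕ} (G : SimpleGraph (Fin n)), H.IsIndContained G ↔ graphS5.IsIndContained G :=
    let e := SimpleGraph.Iso.comap finProdFinEquiv.symm graphS5
    fun G => ⟨fun h => .trans ⟨e.symm.toEmbedding⟩ h, fun h => .trans ⟨e.toEmbedding⟩ h⟩
  obtain ⟨p, f, hpf⟩ := GraphFormula.polyTimeRecognizable (.conj
    [.neg (.contains twoEdges), .neg (.contains fourCycle), .neg (.contains fiveCycle),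
      .neg (.contains gem), .neg (.contains H)])
  refine ⟨p, f, fun n G => ?_⟩
  obtain ⟨t, R, h1, h2, h3⟩ := hpf n G
  refine ⟨t, R, h1, h2, h3.trans ?_⟩
  simp only [GraphFormula.eval_conj, List.forall_mem_cons, GraphFormula.Eval,
    GraphFormula.eval_contains, hH]
  have hsplit := isSplitGraph_iff (G := G)
  constructor
  · rintro ⟨h2, h4, h5, hg, hS, -⟩
    have hs := hsplit.2 ⟨h2, h4, h5⟩
    obtain ⟨C, S, hCS⟩ := hs
    exact ⟨⟨C, S, hCS⟩, hg, (hCS.isLGraph_iff hg).2 hS⟩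
  · rintro ⟨hs, hg, hL⟩
    obtain ⟨h2, h4, h5⟩ := hsplit.1 hs
    obtain ⟨C, S, hCS⟩ := hs
    exact ⟨h2, h4, h5, hg, (hCS.isLGraph_iff hg).1 hL, by simp⟩

theorem mainTheorem3 :
    (∀ {V : Type*} [Finite V] (G : SimpleGraph V) (C S : Set V),
      IsSplitPartition G C S → ¬ gem.IsIndContained G →
        (IsLGraph G ↔ ¬ graphS5.IsIndContained G)) ∧
    PolyTimeRecognizable (fun _ G =>
      IsSplitGraph G ∧ ¬ gem.IsIndContained G ∧ IsLGraph G) :=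
  ⟨fun _ _ _ h hg => h.isLGraph_iff hg, polyTimeRecognizable_gemFree_split_isLGraph⟩
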